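/- Let $N\ge 1$ be an integer and let $M\neq 0$ be a real number. All integrals over compact groups are with respect to Haar measure of total mass $1$. A "contour $\Gamma$ enclosing points $p_1,\dots,p_N$ counter-clockwise" means a closed (e.g. piecewise $C^1$) curve in $\mathbb{C}$ that avoids all $p_i$ and has winding number $1$ around each of them. (i) Let $X,Y$ be complex Hermitian $N\times N$ matrices, let $x_1,\dots,x_N\in\mathbb{R}$ be the eigenvalues of $X$ with multiplicity, and suppose that $Y$ has rank one with non-zero eigenvalue $y$ (more generally, that the eigenvalues of $Y$ with multiplicity are $y,0,\dots,0$ for some real $y$). Then, for every contour $\Gamma$ enclosing $x_1y,\dots,x_Ny$ counter-clockwise, $$\int_{U(N)} e^{M\,\mathrm{tr}(XgYg^{\dagger})}\,dg=\frac{(N-1)!}{M^{N-1}}\;\frac{1}{2\pi i}\oint_{\Gamma}e^{Mt}\prod_{i=1}^N (t-x_iy)^{-1}\,dt .$$ (ii) Let $Sp(N)$ be the group of quaternionic $N\times N$ matrices $g$ with $gg^*=g^*g=1$. Let $X,Y$ be quaternionic Hermitian $N\times N$ matrices, let $x_1,\dots,x_N\in\mathbb{R}$ be the eigenvalues of $X$,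 each listed as often as the dimension over the quaternions of its eigenspace, and suppose that $Y$ has rank one with non-zero eigenvalue $y$ (more generally, that its eigenvalues, listed in the same way, are $y,0,\dots,0$). Then, for every contour $\Gamma$ enclosing $x_1y,\dots,x_Ny$ counter-clockwise, $$\int_{Sp(N)} e^{M\,\mathrm{Re}\,\mathrm{tr}(XgYg^{-1})}\,dg=\frac{(2N-1)!}{M^{2N-1}}\;\frac{1}{2\pi i}\oint_{\Gamma}e^{Mt}\prod_{i=1}^N (t-x_iy)^{-2}\,dt .$$ -/

import Mathlib

open scoped Quaternion
open MeasureTheory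

noncomputable section

namespace RankOneIntegral

/-! ### The compact groups `U(N)` and `Sp(N)` and integration against Haar measure -/

/-- The compact symplectic group `Sp(N)`, as the group of `N × N` quaternionic matrices `g` with
`g* g = g g* = 1`. -/
abbrev Sp (N : ℕ) : Submonoid (Matrix (Fin N) (Fin N) ℍ) :=
  unitary (Matrix (Fin N) (Fin N) ℍ)

theorem norm_entry_le_one_of_mul_star {K : Type*} [NormedRing K] [NormedAlgebra ℝ K]
    [Nontrivial K] [StarRing K]
    (h : ∀ a : K, a * star a = algebraMap ℝ K (‖a‖ ^ 2)) (N : ℕ)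
    (g : Matrix (Fin N) (Fin N) K) (hg : g * star g = 1) (i j : Fin N) : ‖g i j‖ ≤ 1 := by
  have h1 : (g * star g) i i = 1 := by rw [hg, Matrix.one_apply_eq]
  have h2 : algebraMap ℝ K (∑ k, ‖g i k‖ ^ 2) = algebraMap ℝ K 1 := by
    rw [map_sum, map_one, ← h1, Matrix.mul_apply]
    exact Finset.sum_congr rfl fun k _ => (h (g i k)).symm
  have h3 : ∑ k, ‖g i k‖ ^ 2 = 1 := (algebraMap ℝ K).injective h2
  have h4 : ‖g i j‖ ^ 2 ≤ 1 := h3 ▸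
    Finset.single_le_sum (f := fun k => ‖g i k‖ ^ 2) (fun k _ => sq_nonneg _) (Finset.mem_univ j)
  exact (sq_le_one_iff₀ (norm_nonneg _)).1 h4

theorem isCompact_unitary_of_mul_star {K : Type*} [NormedRing K] [NormedAlgebra ℝ K]
    [Nontrivial K] [StarRing K] [ContinuousStar K] [ProperSpace K]
    (h : ∀ a : K, a * star a = algebraMap ℝ K (‖a‖ ^ 2)) (N : ℕ) :
    IsCompact (unitary (Matrix (Fin N) (Fin N) K) : Set (Matrix (Fin N) (Fin N) K)) := by
  have hbox : IsCompact (Set.univ.pi fun _ : Fin N => Set.univ.pi fun _ : Fin N =>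
      Metric.closedBall (0 : K) 1) :=
    isCompact_univ_pi fun _ => isCompact_univ_pi fun _ => isCompact_closedBall _ _
  have hclosed : IsClosed
      (unitary (Matrix (Fin N) (Fin N) K) : Set (Matrix (Fin N) (Fin N) K)) := by
    have : (unitary (Matrix (Fin N) (Fin N) K) : Set (Matrix (Fin N) (Fin N) K))
        = {g | star g * g = 1} ∩ {g | g * star g = 1} := by
      ext g
      exact Unitary.mem_iff
    rw [this]
    exact (isClosed_eq (continuous_star.mul continuous_id) continuous_const).inter
      (isClosed_eq (continuous_id.mul continuous_star) continuous_const)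
  have hentry : ∀ g : Matrix (Fin N) (Fin N) K, g ∈ unitary (Matrix (Fin N) (Fin N) K) →
      ∀ i j, ‖g i j‖ ≤ 1 := fun g hg =>
    norm_entry_le_one_of_mul_star h N g (Unitary.mem_iff.1 hg).2
  refine hbox.of_isClosed_subset hclosed ?_
  intro g hg i _ j _
  rw [mem_closedBall_zero_iff]
  exact hentry g hg i j

instance instCompactSpaceUnitary (N : ℕ) : CompactSpace (Matrix.unitaryGroup (Fin N) ℂ) :=
  isCompact_iff_compactSpace.1 <| isCompact_unitary_of_mul_star (K := ℂ)
    (fun a => by simpa using Complex.mul_conj' a) N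

instance instProperSpaceQuaternion : ProperSpace ℍ := FiniteDimensional.proper_real ℍ

instance instCompactSpaceSp (N : ℕ) : CompactSpace (Sp N) :=
  isCompact_iff_compactSpace.1 <| isCompact_unitary_of_mul_star (K := ℍ)
    (fun a => by
      rw [Quaternion.self_mul_star, Quaternion.normSq_eq_norm_mul_self, sq]; rfl) N

/-- The integral `∫_G f(g) dg` over a compact group `G`, where `dg` is the Haar measure on the
Borel sets of `G` normalized to have total mass `1`. -/
def haarIntegral (G : Type*) [Group G] [TopologicalSpace G] [IsTopologicalGroup G]
    [CompactSpace G] (f : G → ℂ) : ℂ :=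
  letI : MeasurableSpace G := borel G
  haveI : BorelSpace G := ⟨rfl⟩
  ∫ g, f g ∂(Measure.haarMeasure (⊤ : TopologicalSpace.PositiveCompacts G))

/-! ### Eigenvalues of quaternionic Hermitian matrices -/

/-- The eigenspace of a quaternionic matrix `X` for the real number `l`: the space of column
vectors `v` with `X v = v l`, as a right vector space over the quaternions. -/
def eigenspace {N : ℕ} (X : Matrix (Fin N) (Fin N) ℍ) (l : ℝ) :
    Submodule ℍᵐᵒᵖ (Fin N → ℍ) where
  carrier := {v | X.mulVec v = l • v}
  add_mem' {v w} hv hw := by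
    simp only [Set.mem_ofPred_eq] at *
    rw [Matrix.mulVec_add, hv, hw, smul_add]
  zero_mem' := by simp
  smul_mem' q v hv := by
    simp only [Set.mem_ofPred_eq] at *
    rw [Matrix.mulVec_smul, hv, smul_comm]

/-- The real numbers `x i` are the eigenvalues of the quaternionic Hermitian matrix `X`, listed with
multiplicity: every real `l` occurs in the list as often as the dimension over the quaternions of
the eigenspace of `X` for `l`. -/
def IsEigenvalueList {N : ℕ} (X : Matrix (Fin N) (Fin N) ℍ) (x : Fin N → ℝ) : Prop :=
  ∀ l : ℝ, Module.finrank ℍᵐᵒᵖ (eigenspace X l) = (Finset.univ.filter fun i => x i = l).card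

/-! ### Contour integrals -/

/-- `γ`, restricted to `[0, 1]`, is a closed contour: continuous, closed, and differentiable outside
a finite set with integrable derivative. This includes all piecewise `C¹` closed curves. -/
structure IsClosedContour (γ : ℝ → ℂ) : Prop where
  continuousOn : ContinuousOn γ (Set.Icc 0 1)
  closed : γ 0 = γ 1
  differentiableAt : ∃ S : Finset ℝ, ∀ s ∈ Set.Ioo (0 : ℝ) 1, s ∉ S → DifferentiableAt ℝ γ s
  integrable : IntervalIntegrable (deriv γ) volume 0 1

/-- The contour integral `∫_γ f(t) dt`. -/
def contourIntegral (γ : ℝ → ℂ) (f : ℂ → ℂ) : ℂ :=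
  ∫ s in (0 : ℝ)..1, f (γ s) * deriv γ s

/-- The contour `γ` encloses the point `p` once in the counter-clockwise direction: it avoids `p`
and has winding number `1` around `p`. -/
def Encloses (γ : ℝ → ℂ) (p : ℂ) : Prop :=
  (∀ s ∈ Set.Icc (0 : ℝ) 1, γ s ≠ p) ∧
    (2 * Real.pi * Complex.I)⁻¹ * contourIntegral γ (fun t => (t - p)⁻¹) = 1

end RankOneIntegral

end

open RankOneIntegral

/-! Both cases are treated at once over a division algebra `K` of real dimension `2 * m`, with `m =
1` for ℂ and `m = 2` for ℍ; the only property of the norm used is `a * star a = ‖a‖ ^ 2`.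
Diagonalizing `X` and `Y` and absorbing the two unitaries into `g` by bi-invariance of Haar measure
turns the exponent into `M` times the form `∑ a i * ‖g i j‖ ^ 2`, where `a i = x i * y`, in a single
column of `g`. Both sides are then expanded in powers of `M`.

On the group side, the moments of this form come from a Gaussian vector in `K ^ N`. Its moments
factor over coordinates and have generating function `∏ (1 - a i X) ^ (-m)`, up to `n !` and a
constant. Averaging over the unitary group instead, which preserves the Gaussian and acts
transitively on spheres, separates the length of the vector from its direction; dividing by the case
`a = 1` leaves the column moment (`integral_diagForm_column_pow`).

On the contour side, the moments of `∏ (t - a i) ^ (-m)` have generating function `X ^ (m * N - 1) *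
∏ (1 - a i X) ^ (-m)` (`mk_poleMoment_mul_prod`). The two expansions agree after a shift by `m * N -
1`, which accounts for the prefactor (`haarIntegral_exp_diagForm`). -/

noncomputable section

namespace RankOneIntegral

/-! ### Contour integrals of rational functions with prescribed poles -/

namespace IsClosedContour

variable {γ : ℝ → ℂ}

theorem intervalIntegrable_mul_deriv (hγ : IsClosedContour γ) {f : ℂ → ℂ}
    (hf : ∀ s ∈ Set.Icc (0 : ℝ) 1, ContinuousAt f (γ s)) :
    IntervalIntegrable (fun s => f (γ s) * deriv γ s) volume 0 1 := by
  refine hγ.integrable.continuousOn_mul ?_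
  rw [Set.uIcc_of_le zero_le_one]
  exact fun s hs => (hf s hs).comp_continuousWithinAt (hγ.continuousOn s hs)

theorem contourIntegral_add (hγ : IsClosedContour γ) {f g : ℂ → ℂ}
    (hf : ∀ s ∈ Set.Icc (0 : ℝ) 1, ContinuousAt f (γ s))
    (hg : ∀ s ∈ Set.Icc (0 : ℝ) 1, ContinuousAt g (γ s)) :
    contourIntegral γ (fun t => f t + g t) = contourIntegral γ f + contourIntegral γ g := by
  simp only [contourIntegral, add_mul]
  exact intervalIntegral.integral_add (hγ.intervalIntegrable_mul_deriv hf)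
    (hγ.intervalIntegrable_mul_deriv hg)

theorem contourIntegral_const_mul (c : ℂ) (f : ℂ → ℂ) :
    contourIntegral γ (fun t => c * f t) = c * contourIntegral γ f := by
  simp only [contourIntegral, mul_assoc]
  exact intervalIntegral.integral_const_mul _ _

theorem contourIntegral_congr {f g : ℂ → ℂ}
    (h : ∀ s ∈ Set.Icc (0 : ℝ) 1, f (γ s) = g (γ s)) :
    contourIntegral γ f = contourIntegral γ g := by
  refine intervalIntegral.integral_congr fun s hs => ?_
  rw [Set.uIcc_of_le zero_le_one] at hs
  simp only [h s hs]

/-- Fundamental theorem of calculus along the curve. Together with the winding numbers it does the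
work of the residue theorem: integrands are reduced to ones with a primitive or to simple poles. -/
theorem contourIntegral_eq_zero_of_hasDerivAt (hγ : IsClosedContour γ) {F f : ℂ → ℂ}
    (hF : ∀ s ∈ Set.Icc (0 : ℝ) 1, HasDerivAt F (f (γ s)) (γ s))
    (hf : ∀ s ∈ Set.Icc (0 : ℝ) 1, ContinuousAt f (γ s)) :
    contourIntegral γ f = 0 := by
  obtain ⟨S, hS⟩ := hγ.differentiableAt
  have key := integral_eq_of_hasDerivAt_off_countable (fun s => F (γ s))
    (fun s => f (γ s) * deriv γ s) (a := 0) (b := 1) S.countable_toSet ?_ ?_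
    (hγ.intervalIntegrable_mul_deriv hf)
  · rw [contourIntegral, key, hγ.closed, sub_self]
  · rw [Set.uIcc_of_le zero_le_one]
    exact fun s hs => (hF s hs).continuousAt.comp_continuousWithinAt (hγ.continuousOn s hs)
  · rintro s ⟨hs, hsS⟩
    rw [min_eq_left zero_le_one, max_eq_right zero_le_one] at hs
    exact (hF s (Set.Ioo_subset_Icc_self hs)).comp s
      (hS s hs hsS).hasDerivAt

end IsClosedContour

/-- The rational function with poles at the points of `A`, with multiplicity. -/
def poleProd (A : Multiset ℂ) (t : ℂ) : ℂ := (A.map fun a => (t - a)⁻¹).prod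

@[simp] theorem poleProd_zero (t : ℂ) : poleProd 0 t = 1 := by simp [poleProd]

@[simp] theorem poleProd_cons (a : ℂ) (A : Multiset ℂ) (t : ℂ) :
    poleProd (a ::ₘ A) t = (t - a)⁻¹ * poleProd A t := by simp [poleProd]

theorem continuousAt_poleProd {A : Multiset ℂ} {t : ℂ} (ht : ∀ a ∈ A, t ≠ a) :
    ContinuousAt (poleProd A) t := by
  induction A using Multiset.induction_on with
  | empty => exact continuousAt_const.congr (.of_forall fun t => (poleProd_zero t).symm)
  | cons a A ih =>
    have h1 : ContinuousAt (fun t : ℂ => (t - a)⁻¹) t :=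
      (continuousAt_id.sub continuousAt_const).inv₀
        (sub_ne_zero.2 (ht a (Multiset.mem_cons_self a A)))
    exact (h1.mul (ih fun b hb => ht b (Multiset.mem_cons_of_mem hb))).congr
      (.of_forall fun t => (poleProd_cons a A t).symm)

/-- The normalized contour integral of `t ^ k` against the rational function with poles `A`. -/
def poleMoment (γ : ℝ → ℂ) (A : Multiset ℂ) (k : ℕ) : ℂ :=
  (2 * Real.pi * Complex.I)⁻¹ * contourIntegral γ (fun t => t ^ k * poleProd A t)

section

variable {γ : ℝ → ℂ} {A : Multiset ℂ}

theorem Encloses.avoid (hA : ∀ a ∈ A, Encloses γ a) :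
    ∀ s ∈ Set.Icc (0 : ℝ) 1, ∀ a ∈ A, γ s ≠ a :=
  fun s hs a ha => (hA a ha).1 s hs

theorem poleMoment_zero (hγ : IsClosedContour γ) (k : ℕ) : poleMoment γ 0 k = 0 := by
  rw [poleMoment, hγ.contourIntegral_eq_zero_of_hasDerivAt
    (F := fun t => (k + 1 : ℂ)⁻¹ * t ^ (k + 1)), mul_zero]
  · intro s _
    have h : (k + 1 : ℂ) ≠ 0 := Nat.cast_add_one_ne_zero k
    refine ((hasDerivAt_pow (k + 1) (γ s)).const_mul (k + 1 : ℂ)⁻¹).congr_deriv ?_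
    rw [poleProd_zero, Nat.add_sub_cancel, Nat.cast_add_one]
    field_simp
  · intro s _
    simp only [poleProd_zero]
    fun_prop

theorem contourIntegral_sub_inv_pow (hγ : IsClosedContour γ) {a : ℂ}
    (ha : ∀ s ∈ Set.Icc (0 : ℝ) 1, γ s ≠ a) (n : ℕ) :
    contourIntegral γ (fun t => (t - a)⁻¹ ^ (n + 2)) = 0 := by
  refine hγ.contourIntegral_eq_zero_of_hasDerivAt
    (F := fun t => -(n + 1 : ℂ)⁻¹ * (t - a)⁻¹ ^ (n + 1)) ?_ ?_
  · intro s hs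
    have h0 : γ s - a ≠ 0 := sub_ne_zero.2 (ha s hs)
    have h : (n + 1 : ℂ) ≠ 0 := Nat.cast_add_one_ne_zero n
    have h1 : HasDerivAt (fun t : ℂ => (t - a)⁻¹) (-1 / (γ s - a) ^ 2) (γ s) :=
      ((hasDerivAt_id (γ s)).sub_const a).inv h0
    refine ((h1.pow (n + 1)).const_mul (-(n + 1 : ℂ)⁻¹)).congr_deriv ?_
    rw [Nat.add_sub_cancel, Nat.cast_add_one]
    simp only [inv_pow]
    field_simp
    ring
  · intro s hs
    exact ((continuousAt_id.sub continuousAt_const).inv₀ (sub_ne_zero.2 (ha s hs))).pow _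

/-- One pole gives its winding number. With more poles, either all coincide and a primitive exists,
or two differ and partial fractions reduce to fewer poles. -/
theorem poleMoment_order_zero (hγ : IsClosedContour γ) (n : ℕ) :
    ∀ A : Multiset ℂ, A.card = n + 1 → (∀ a ∈ A, Encloses γ a) →
      poleMoment γ A 0 = if n = 0 then 1 else 0 := by
  induction n with
  | zero =>
    intro A hA hE
    obtain ⟨a, rfl⟩ := Multiset.card_eq_one.1 hA
    simpa [poleMoment, poleProd] using (hE a (by simp)).2
  | succ n ih =>
    intro A hA hE
    rw [if_neg n.succ_ne_zero]
    obtain ⟨a, B, rfl⟩ : ∃ a B, A = a ::ₘ B := by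
      obtain ⟨a, ha⟩ := Multiset.card_pos_iff_exists_mem.1 (by omega : 0 < A.card)
      exact ⟨a, _, (Multiset.cons_erase ha).symm⟩
    by_cases hall : ∀ b ∈ B, b = a
    · have hB : B = Multiset.replicate (n + 1) a := by
        rw [Multiset.eq_replicate]
        exact ⟨by simpa using hA, hall⟩
      subst hB
      have := contourIntegral_sub_inv_pow hγ (hE a (by simp)).1 n
      have h : poleProd (a ::ₘ Multiset.replicate (n + 1) a) = fun t => (t - a)⁻¹ ^ (n + 2) := by
        ext t
        rw [poleProd_cons, poleProd, Multiset.map_replicate, Multiset.prod_replicate, ← pow_succ']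
      simp only [poleMoment, pow_zero, one_mul, h, this, mul_zero]
    · push Not at hall
      obtain ⟨b, hb, hba⟩ := hall
      obtain ⟨C, rfl⟩ : ∃ C, B = b ::ₘ C := ⟨_, (Multiset.cons_erase hb).symm⟩
      have hC : C.card = n := by simpa using hA
      have h1 := ih (a ::ₘ C) (by simp [hC]) (fun c hc => hE c (by
        simp only [Multiset.mem_cons] at hc ⊢; tauto))
      have h2 := ih (b ::ₘ C) (by simp [hC]) (fun c hc => hE c (by
        simp only [Multiset.mem_cons] at hc ⊢; tauto))
      have hav := Encloses.avoid hE
      -- This is `1/(t-a) = (a-b)/((t-a)(t-b)) + 1/(t-b)`. By induction the integrals for `a ::ₘ C`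
      -- and `b ::ₘ C` coincide, so the middle one vanishes.
      have h3 : contourIntegral γ (fun t => poleProd (a ::ₘ C) t) =
          contourIntegral γ (fun t => (a - b) * poleProd (a ::ₘ b ::ₘ C) t) +
          contourIntegral γ (fun t => poleProd (b ::ₘ C) t) := by
        rw [← hγ.contourIntegral_add]
        · refine IsClosedContour.contourIntegral_congr fun s hs => ?_
          have ha0 := sub_ne_zero.2 (hav s hs a (by simp))
          have hb0 := sub_ne_zero.2 (hav s hs b (by simp))
          simp only [poleProd_cons]
          field_simp
          ring
        · exact fun s hs => continuousAt_const.mul (continuousAt_poleProd (hav s hs))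
        · exact fun s hs => continuousAt_poleProd
            fun c hc => hav s hs c (Multiset.mem_cons_of_mem hc)
      rw [IsClosedContour.contourIntegral_const_mul] at h3
      simp only [poleMoment, pow_zero, one_mul] at h1 h2 ⊢
      rw [h3, mul_add, h2] at h1
      have h4 := add_eq_right.1 h1
      rw [mul_left_comm] at h4
      exact (mul_eq_zero.1 h4).resolve_left (sub_ne_zero.2 hba.symm)

/-- Write one factor `t` as `a + (t - a)`; the second summand cancels the pole at `a`. -/
theorem poleMoment_cons_succ (hγ : IsClosedContour γ) {a : ℂ}
    (hA : ∀ b ∈ a ::ₘ A, Encloses γ b) (k : ℕ) :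
    poleMoment γ (a ::ₘ A) (k + 1) = a * poleMoment γ (a ::ₘ A) k + poleMoment γ A k := by
  have hav := Encloses.avoid hA
  have h : contourIntegral γ (fun t => t ^ (k + 1) * poleProd (a ::ₘ A) t) =
      contourIntegral γ (fun t => a * (t ^ k * poleProd (a ::ₘ A) t)) +
      contourIntegral γ (fun t => t ^ k * poleProd A t) := by
    rw [← hγ.contourIntegral_add]
    · refine IsClosedContour.contourIntegral_congr fun s hs => ?_
      have ha0 := sub_ne_zero.2 (hav s hs a (by simp))
      simp only [poleProd_cons]
      field_simp
      ring
    · exact fun s hs => continuousAt_const.mul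
        ((continuousAt_id.pow k).mul (continuousAt_poleProd (hav s hs)))
    · exact fun s hs => (continuousAt_id.pow k).mul (continuousAt_poleProd
            fun c hc => hav s hs c (Multiset.mem_cons_of_mem hc))
  rw [IsClosedContour.contourIntegral_const_mul] at h
  simp only [poleMoment]
  rw [h]
  ring

open PowerSeries in
/-- The generating function of the moments of a rational function with poles inside the contour. -/
theorem mk_poleMoment_mul_prod (hγ : IsClosedContour γ) (n : ℕ) :
    ∀ A : Multiset ℂ, A.card = n + 1 → (∀ a ∈ A, Encloses γ a) →
      PowerSeries.mk (poleMoment γ A) * (A.map fun a => 1 - C a * X).prod = X ^ n := by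
  induction n with
  | zero =>
    intro A hA hE
    obtain ⟨a, rfl⟩ := Multiset.card_eq_one.1 hA
    rw [Multiset.map_singleton, Multiset.prod_singleton, pow_zero]
    ext k
    rw [mul_sub, mul_one, mul_left_comm, map_sub, coeff_C_mul, coeff_mk]
    cases k with
    | zero => simp [poleMoment_order_zero hγ 0 {a} hA hE]
    | succ k =>
      have := poleMoment_cons_succ (A := 0) (a := a) hγ hE k
      rw [poleMoment_zero hγ, add_zero] at this
      rw [coeff_succ_mul_X, coeff_mk, coeff_one, if_neg k.succ_ne_zero]
      exact sub_eq_zero.2 this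
  | succ n ih =>
    intro A hA hE
    obtain ⟨a, B, rfl⟩ : ∃ a B, A = a ::ₘ B := by
      obtain ⟨a, ha⟩ := Multiset.card_pos_iff_exists_mem.1 (by omega : 0 < A.card)
      exact ⟨a, _, (Multiset.cons_erase ha).symm⟩
    have hB := ih B (by simpa using hA) fun b hb => hE b (Multiset.mem_cons_of_mem hb)
    -- The moment recurrence in generating-function form: removing a pole costs one factor `X`.
    suffices h : PowerSeries.mk (poleMoment γ (a ::ₘ B)) * (1 - C a * X) =
        PowerSeries.mk (poleMoment γ B) * X by
      rw [Multiset.map_cons, Multiset.prod_cons, ← mul_assoc, h, pow_succ, ← hB, mul_right_comm]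
    ext k
    rw [mul_sub, mul_one, mul_left_comm, map_sub, coeff_C_mul, coeff_mk]
    cases k with
    | zero => simp [poleMoment_order_zero hγ _ _ hA hE]
    | succ k =>
      rw [coeff_succ_mul_X, coeff_succ_mul_X, coeff_mk, coeff_mk, poleMoment_cons_succ hγ hE]
      ring

/-- Expansion of the exponential under a contour integral. -/
theorem hasSum_poleMoment_exp (hγ : IsClosedContour γ) (hA : ∀ a ∈ A, Encloses γ a) (M : ℂ) :
    HasSum (fun k : ℕ => M ^ k / k.factorial * poleMoment γ A k)
      ((2 * Real.pi * Complex.I)⁻¹ *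
        contourIntegral γ (fun t => Complex.exp (M * t) * poleProd A t)) := by
  have hav := Encloses.avoid hA
  obtain ⟨R, hR⟩ := (isCompact_Icc.image_of_continuousOn hγ.continuousOn).isBounded.exists_norm_le
  have hsub : Set.uIoc (0 : ℝ) 1 ⊆ Set.Icc 0 1 := by
    rw [Set.uIoc_of_le zero_le_one]
    exact Set.Ioc_subset_Icc_self
  have hint : IntervalIntegrable (fun s => poleProd A (γ s) * deriv γ s) volume 0 1 :=
    hγ.intervalIntegrable_mul_deriv fun s hs => continuousAt_poleProd (hav s hs)
  have hsum : ∀ c : ℝ, HasSum (fun k : ℕ => (‖M‖ * R) ^ k / k.factorial * c)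
      (Real.exp (‖M‖ * R) * c) := fun c => by
    rw [Real.exp_eq_exp_ℝ]
    exact (NormedSpace.expSeries_div_hasSum_exp (‖M‖ * R)).mul_right c
  -- Since `‖γ s‖ ≤ R`, the terms are dominated by the exponential series at `‖M‖ * R`, times the
  -- integrable remaining factor.
  have key := intervalIntegral.hasSum_integral_of_dominated_convergence
    (F := fun (k : ℕ) s => M ^ k / k.factorial * (γ s ^ k * poleProd A (γ s) * deriv γ s))
    (f := fun s => Complex.exp (M * γ s) * poleProd A (γ s) * deriv γ s)
    (a := 0) (b := 1) (μ := volume)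
    (fun k s => (‖M‖ * R) ^ k / k.factorial * ‖poleProd A (γ s) * deriv γ s‖) ?_ ?_ ?_ ?_ ?_
  · refine Eq.mpr (congrArg (HasSum · _) (funext fun k => ?_)) (key.mul_left (2 * Real.pi * Complex.I)⁻¹)
    rw [intervalIntegral.integral_const_mul, poleMoment, contourIntegral, mul_left_comm]
  · intro k
    have h := hγ.intervalIntegrable_mul_deriv (f := fun t => t ^ k * poleProd A t)
      fun s hs => (continuousAt_id.pow k).mul (continuousAt_poleProd (hav s hs))
    exact (h.const_mul _).def'.aestronglyMeasurable
  · refine fun k => .of_forall fun s hs => ?_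
    have h1 : ‖γ s‖ ≤ R := hR _ (Set.mem_image_of_mem _ (hsub hs))
    rw [mul_assoc, norm_mul, norm_mul, norm_div, norm_pow, norm_pow, Complex.norm_natCast, mul_pow,
      ← mul_assoc, div_mul_eq_mul_div]
    gcongr
  · exact .of_forall fun s _ => (hsum _).summable
  · simp_rw [fun s => (hsum ‖poleProd A (γ s) * deriv γ s‖).tsum_eq]
    exact hint.norm.const_mul _
  · refine .of_forall fun s _ => ?_
    have h := (NormedSpace.expSeries_div_hasSum_exp (M * γ s)).mul_right
      (poleProd A (γ s) * deriv γ s)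
    rw [← Complex.exp_eq_exp_ℂ, ← mul_assoc] at h
    refine Eq.mpr (congrArg (HasSum · _) (funext fun k => ?_)) h
    rw [mul_pow]
    ring

end

/-! ### Gaussian moments of diagonal quadratic forms -/

section

variable {E : Type*} [NormedAddCommGroup E] variable {N : ℕ}

/-- The diagonal quadratic form with coefficients `a`. -/
def diagForm (a : Fin N → ℝ) (v : Fin N → E) : ℝ := ∑ i, a i * ‖v i‖ ^ 2

theorem continuous_diagForm (a : Fin N → ℝ) : Continuous (diagForm a : (Fin N → E) → ℝ) := by
  unfold diagForm
  fun_prop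

/-- Powers of a diagonal form times the Gaussian density, expanded by the multinomial theorem. -/
theorem diagForm_pow_mul_exp (a : Fin N → ℝ) (n : ℕ) (v : Fin N → E) :
    diagForm a v ^ n * Real.exp (-diagForm 1 v) =
      ∑ k ∈ Finset.univ.piAntidiag n, (Nat.multinomial Finset.univ k : ℝ) *
        ∏ i, (a i ^ k i * ((‖v i‖ ^ 2) ^ k i * Real.exp (-‖v i‖ ^ 2))) := by
  simp only [diagForm, Pi.one_apply, one_mul, Finset.sum_pow_eq_sum_piAntidiag,
    ← Finset.sum_neg_distrib, Real.exp_sum, Finset.sum_mul, mul_assoc, ← Finset.prod_mul_distrib,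
    mul_pow]

end

section

variable {E : Type*} [NormedAddCommGroup E] [NormedSpace ℝ E] [FiniteDimensional ℝ E]
  [MeasurableSpace E] [BorelSpace E] (μ : Measure E) [μ.IsAddHaarMeasure]

theorem integral_pow_mul_exp_neg_sq (m k : ℕ) (hm : 0 < m) :
    ∫ r in Set.Ioi (0 : ℝ), r ^ (2 * m - 1) * ((r ^ 2) ^ k * Real.exp (-r ^ 2)) =
      (m + k - 1).factorial / 2 := by
  have h := integral_rpow_mul_exp_neg_rpow (p := 2) (q := (2 * (m + k) - 1 : ℕ)) two_pos
    (lt_of_lt_of_le neg_one_lt_zero (Nat.cast_nonneg _))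
  have h2 : ((2 * (m + k) - 1 : ℕ) + 1 : ℝ) / 2 = ((m + k - 1 : ℕ) : ℝ) + 1 := by
    rw [← Nat.cast_add_one, ← Nat.cast_add_one, Nat.sub_add_cancel (by omega),
      Nat.sub_add_cancel (by omega)]
    push_cast
    ring
  rw [h2, Real.Gamma_nat_eq_factorial] at h
  rw [div_eq_inv_mul, ← one_div, ← h]
  refine setIntegral_congr_fun measurableSet_Ioi fun r _ => ?_
  simp only [Real.rpow_natCast, Real.rpow_two, ← pow_mul, ← mul_assoc, ← pow_add]
  congr 2
  omega

/-- The moments of `‖z‖ ^ 2` against a Gaussian density on a space of dimension `2 * m`. -/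
theorem exists_integral_norm_sq_pow_mul_exp (m : ℕ) (hm : 0 < m)
    (hE : Module.finrank ℝ E = 2 * m) :
    ∃ c : ℝ, 0 < c ∧ ∀ k : ℕ, ∫ z, (‖z‖ ^ 2) ^ k * Real.exp (-‖z‖ ^ 2) ∂μ =
      c * (k.factorial * (m - 1 + k).choose (m - 1)) := by
  have : Nontrivial E := Module.nontrivial_of_finrank_pos (R := ℝ) (by omega)
  have hball : 0 < μ.real (Metric.ball 0 1) :=
    ENNReal.toReal_pos (Metric.measure_ball_pos μ _ one_pos).ne' measure_ball_lt_top.ne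
  -- Polar coordinates give `2 * m` times the ball volume; the radial integral gives `(m + k - 1)! /
  -- 2`, from which `(m - 1)!` is split off so that the constant does not depend on `k`.
  refine ⟨m * μ.real (Metric.ball 0 1) * (m - 1).factorial, by positivity, fun k => ?_⟩
  have h1 : (m + k - 1).factorial = k.factorial * (m - 1 + k).choose (m - 1) * (m - 1).factorial := by
    rw [Nat.sub_add_comm hm, Nat.succ_eq_add_one, zero_add,
      ← Nat.choose_mul_factorial_mul_factorial (Nat.le_add_right (m - 1) k), Nat.add_sub_cancel_left]
    ring
  rw [integral_fun_norm_addHaar μ (fun r => (r ^ 2) ^ k * Real.exp (-r ^ 2)), hE]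
  simp only [smul_eq_mul, nsmul_eq_mul]
  rw [integral_pow_mul_exp_neg_sq m k hm, h1]
  push_cast
  ring

theorem integrable_norm_sq_pow_mul_exp (m : ℕ) (hm : 0 < m)
    (hE : Module.finrank ℝ E = 2 * m) (k : ℕ) :
    Integrable (fun z => (‖z‖ ^ 2) ^ k * Real.exp (-‖z‖ ^ 2)) μ := by
  obtain ⟨c, hc, h⟩ := exists_integral_norm_sq_pow_mul_exp μ m hm hE
  -- The integral of a non-integrable function is `0` by convention, so a nonzero value proves
  -- integrability.
  refine not_imp_comm.1 integral_undef ?_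
  rw [h k]
  have := Nat.choose_pos (n := m - 1 + k) (k := m - 1) (by omega)
  positivity

variable {N : ℕ}

theorem integrable_diagForm_pow_mul_exp (m : ℕ) (hm : 0 < m) (hE : Module.finrank ℝ E = 2 * m)
    (a : Fin N → ℝ) (n : ℕ) :
    Integrable (fun v : Fin N → E => diagForm a v ^ n * Real.exp (-diagForm 1 v))
      (Measure.pi fun _ => μ) := by
  simp only [diagForm_pow_mul_exp]
  refine integrable_finsetSum _ fun k _ => Integrable.const_mul ?_ _
  exact Integrable.fintype_prod (f := fun i (z : E) =>
    a i ^ k i * ((‖z‖ ^ 2) ^ k i * Real.exp (-‖z‖ ^ 2)))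
    fun i => (integrable_norm_sq_pow_mul_exp μ m hm hE _).const_mul _

/-- The generating function `∏ (1 - a i X) ^ (-m)`. -/
def dirichletSeries (m : ℕ) (a : Fin N → ℝ) : PowerSeries ℝ :=
  ∏ i, PowerSeries.mk fun k => a i ^ k * (m - 1 + k).choose (m - 1)

/-- The factorials `k i !` in the coordinate moments cancel the denominator of the multinomial
coefficient, leaving `n !` times a coefficient of a product of series. The constant is independent
of `a` and `n`, so it drops out when two forms are compared. -/
theorem exists_integral_diagForm_pow_mul_exp (m : ℕ) (hm : 0 < m)
    (hE : Module.finrank ℝ E = 2 * m) :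
    ∃ c : ℝ, 0 < c ∧ ∀ (a : Fin N → ℝ) (n : ℕ),
      ∫ v : Fin N → E, diagForm a v ^ n * Real.exp (-diagForm 1 v) ∂(Measure.pi fun _ => μ) =
        c * (n.factorial * PowerSeries.coeff n (dirichletSeries m a)) := by
  obtain ⟨c, hc, h⟩ := exists_integral_norm_sq_pow_mul_exp μ m hm hE
  refine ⟨c ^ N, by positivity, fun a n => ?_⟩
  simp only [diagForm_pow_mul_exp]
  rw [integral_finsetSum]
  · simp only [integral_const_mul]
    rw [dirichletSeries, PowerSeries.coeff_prod, Finset.mul_sum, Finset.mul_sum]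
    refine Finset.sum_nbij' Finsupp.equivFunOnFinite.symm (fun f => ⇑f) ?_ ?_ ?_ ?_ ?_
    · intro k hk
      simpa [Finset.mem_finsuppAntidiag] using hk
    · intro k hk
      simpa [Finset.mem_finsuppAntidiag] using hk
    · exact fun k _ => rfl
    · exact fun k _ => Finsupp.ext fun i => rfl
    · intro k hk
      have hn : ∑ i, k i = n := by simpa using hk
      rw [integral_fintype_prod_eq_prod (f := fun i (z : E) =>
        a i ^ k i * ((‖z‖ ^ 2) ^ k i * Real.exp (-‖z‖ ^ 2)))]
      have hspec : (n.factorial : ℝ) = (∏ i, ((k i).factorial : ℝ)) *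
          (Nat.multinomial Finset.univ k : ℝ) := by
        rw [← hn, ← Nat.multinomial_spec]
        push_cast
        rfl
      simp only [integral_const_mul, h, PowerSeries.coeff_mk, Finsupp.equivFunOnFinite_symm_apply_apply,
        Finset.prod_mul_distrib, Finset.prod_const, Finset.card_univ, Fintype.card_fin, hspec]
      ring
  · exact fun k _ => Integrable.const_mul (Integrable.fintype_prod (f := fun i (z : E) =>
      a i ^ k i * ((‖z‖ ^ 2) ^ k i * Real.exp (-‖z‖ ^ 2)))
      fun i => (integrable_norm_sq_pow_mul_exp μ m hm hE _).const_mul _) _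

open PowerSeries in
theorem mk_mul_one_sub_pow (m : ℕ) (hm : 0 < m) (a : ℝ) :
    (PowerSeries.mk fun k => a ^ k * ((m - 1 + k).choose (m - 1) : ℝ)) * (1 - C a * X) ^ m = 1 := by
  have h := congrArg (rescale a) (mk_add_choose_mul_one_sub_pow_eq_one ℝ (m - 1))
  rw [Nat.sub_add_cancel hm, map_mul, map_pow, map_sub, map_one, rescale_X] at h
  convert h using 2
  ext k
  simp [coeff_rescale]

open PowerSeries in
theorem dirichletSeries_mul_prod (m : ℕ) (hm : 0 < m) (a : Fin N → ℝ) :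
    dirichletSeries m a * ∏ i, (1 - C (a i) * X) ^ m = 1 := by
  rw [dirichletSeries, ← Finset.prod_mul_distrib]
  exact Finset.prod_eq_one fun i _ => mk_mul_one_sub_pow m hm (a i)

open PowerSeries in
theorem coeff_dirichletSeries_one (m : ℕ) (hm : 0 < m) (hN : 0 < N) (n : ℕ) :
    coeff n (dirichletSeries m (1 : Fin N → ℝ)) = (m * N - 1 + n).choose (m * N - 1) := by
  have h1 := dirichletSeries_mul_prod m hm (1 : Fin N → ℝ)
  have h2 := mk_mul_one_sub_pow (m * N) (Nat.mul_pos hm hN) 1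
  simp only [Pi.one_apply, Finset.prod_const, Finset.card_univ, Fintype.card_fin, ← pow_mul] at h1
  have h3 : dirichletSeries m (1 : Fin N → ℝ) = _ :=
    left_inv_eq_right_inv h1 ((mul_comm _ _).trans h2)
  rw [h3, coeff_mk, one_pow, one_mul]

end

/-! ### Unitary matrices over a real normed division algebra -/

section

variable {K : Type*} [NormedDivisionRing K] [NormedAlgebra ℝ K] [StarRing K]

theorem norm_star_of_mul_star (hK : ∀ a : K, a * star a = algebraMap ℝ K (‖a‖ ^ 2)) (a : K) :
    ‖star a‖ = ‖a‖ := by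
  rcases eq_or_ne a 0 with rfl | ha
  · simp
  · have h := congrArg norm (hK a)
    rw [norm_mul, norm_algebraMap', Real.norm_of_nonneg (sq_nonneg _), sq] at h
    exact mul_left_cancel₀ (norm_ne_zero_iff.2 ha) h

theorem star_mul_self_of_mul_star (hK : ∀ a : K, a * star a = algebraMap ℝ K (‖a‖ ^ 2)) (a : K) :
    star a * a = algebraMap ℝ K (‖a‖ ^ 2) := by
  have h := hK (star a)
  rwa [star_star, norm_star_of_mul_star hK] at h

variable {N : ℕ}

theorem star_dotProduct_self (hK : ∀ a : K, a * star a = algebraMap ℝ K (‖a‖ ^ 2))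
    (v : Fin N → K) : star v ⬝ᵥ v = algebraMap ℝ K (diagForm 1 v) := by
  simp [dotProduct, diagForm, star_mul_self_of_mul_star hK]

theorem diagForm_one_mulVec (hK : ∀ a : K, a * star a = algebraMap ℝ K (‖a‖ ^ 2))
    {g : Matrix (Fin N) (Fin N) K} (hg : star g * g = 1) (v : Fin N → K) :
    diagForm 1 (g.mulVec v) = diagForm 1 v := by
  apply (algebraMap ℝ K).injective
  rw [← star_dotProduct_self hK, ← star_dotProduct_self hK, Matrix.star_mulVec,
    ← Matrix.dotProduct_mulVec, Matrix.mulVec_mulVec, ← Matrix.star_eq_conjTranspose, hg,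
    Matrix.one_mulVec]

variable [StarModule ℝ K]

/-- The unitary reflection interchanging two vectors of the same length whose inner product is
real. -/
theorem exists_reflection (hK : ∀ a : K, a * star a = algebraMap ℝ K (‖a‖ ^ 2))
    (e u : Fin N → K) (h1 : diagForm 1 e = diagForm 1 u) (h2 : star u ⬝ᵥ e = star e ⬝ᵥ u) :
    ∃ R ∈ unitary (Matrix (Fin N) (Fin N) K), R.mulVec e = u := by
  set w : Fin N → K := e - u with hw
  set s : ℝ := diagForm 1 w with hs
  have hws : star w ⬝ᵥ w = algebraMap ℝ K s := star_dotProduct_self hK w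
  -- Equal lengths and a symmetric inner product make `⟨w, e⟩` half of `‖w‖²`; this is why the
  -- reflection sends `e` to `e - w = u`.
  have hwe : (2 : ℝ) • (star w ⬝ᵥ e) = algebraMap ℝ K s := by
    have he := star_dotProduct_self hK e
    have hu := star_dotProduct_self hK u
    rw [← hws, hw, star_sub, sub_dotProduct, sub_dotProduct, dotProduct_sub, dotProduct_sub, he,
      hu, h1, h2, two_smul]
    abel
  set P := Matrix.vecMulVec w (star w) with hP
  have hPstar : star P = P := by
    rw [Matrix.star_eq_conjTranspose, hP, Matrix.conjTranspose_vecMulVec, star_star]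
  have hPP : P * P = s • P := by
    rw [hP, Matrix.vecMulVec_mul_vecMulVec, hws, algebraMap_smul]
    ext i j
    simp [Matrix.vecMulVec_apply]
  -- Covers `s = 0`, where `s⁻¹ = 0` makes the reflection the identity, as it should be when `e =
  -- u`.
  have hcs : s⁻¹ * s * s⁻¹ = s⁻¹ := by
    rcases eq_or_ne s 0 with h | h <;> simp [h]
  have hR : star (1 - (2 * s⁻¹) • P) = 1 - (2 * s⁻¹) • P := by
    rw [star_sub, star_one, star_smul, hPstar, star_trivial]
  have hRR : (1 - (2 * s⁻¹) • P) * (1 - (2 * s⁻¹) • P) = 1 := by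
    rw [mul_sub, mul_one, sub_mul, one_mul, smul_mul_smul_comm, hPP, smul_smul,
      show 2 * s⁻¹ * (2 * s⁻¹) * s = 2 * s⁻¹ + 2 * s⁻¹ by linear_combination 4 * hcs, add_smul]
    abel
  refine ⟨1 - (2 * s⁻¹) • P, Unitary.mem_iff.2 ⟨by rw [hR, hRR], by rw [hR, hRR]⟩, ?_⟩
  have hPe : (2 : ℝ) • P.mulVec e = s • w := by
    ext i
    have : P.mulVec e i = w i * (star w ⬝ᵥ e) := by
      simp [hP, Matrix.mulVec, dotProduct, Matrix.vecMulVec_apply, Finset.mul_sum, mul_assoc]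
    rw [Pi.smul_apply, Pi.smul_apply, this, ← mul_smul_comm, hwe, Algebra.smul_def,
      Algebra.commutes]
  rw [Matrix.sub_mulVec, Matrix.one_mulVec, Matrix.smul_mulVec, mul_comm, mul_smul, hPe, smul_smul]
  rcases eq_or_ne s 0 with h0 | h0
  · have hw0 : w = 0 := by
      ext i
      have h3 := (Finset.sum_eq_zero_iff_of_nonneg (fun i _ => mul_nonneg zero_le_one (sq_nonneg _))).1
        (h0 : ∑ i, (1 : Fin N → ℝ) i * ‖w i‖ ^ 2 = 0) i (Finset.mem_univ i)
      simpa using h3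
    rw [hw0, smul_zero, sub_zero]
    exact sub_eq_zero.1 hw0
  · rw [inv_mul_cancel₀ h0, one_smul, hw, sub_sub_cancel]

/-- Unitary matrices act transitively on spheres. -/
theorem exists_unitary_mulVec_single (hK : ∀ a : K, a * star a = algebraMap ℝ K (‖a‖ ^ 2))
    (j : Fin N) (v : Fin N → K) :
    ∃ g ∈ unitary (Matrix (Fin N) (Fin N) K),
      g.mulVec (Pi.single j (algebraMap ℝ K (√(diagForm 1 v)))) = v := by
  have hQ : 0 ≤ diagForm 1 v := Finset.sum_nonneg fun i _ => by simp
  set r := √(diagForm 1 v) with hr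
  -- `q` is the phase of `v j`. Dividing it out on the right makes the `j`-th entry of `u` real, as
  -- the reflection requires; the scalar matrix `D` restores it, since `e` has real entries and
  -- right multiplication commutes with matrices.
  obtain ⟨q, hq, hvq⟩ : ∃ q : K, ‖q‖ = 1 ∧ v j = ‖v j‖ • q := by
    rcases eq_or_ne (v j) 0 with h | h
    · exact ⟨1, by simp, by simp [h]⟩
    · refine ⟨‖v j‖⁻¹ • v j, by simp [norm_smul, h], ?_⟩
      rw [smul_smul, mul_inv_cancel₀ (norm_ne_zero_iff.2 h), one_smul]
  have hqs : q * star q = 1 := by rw [hK, hq]; simp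
  have hsq : star q * q = 1 := by rw [star_mul_self_of_mul_star hK, hq]; simp
  set e : Fin N → K := Pi.single j (algebraMap ℝ K r) with he
  set u : Fin N → K := fun i => v i * star q with hu
  have huj : u j = algebraMap ℝ K ‖v j‖ := by
    change v j * star q = _
    rw [hvq, smul_mul_assoc, hqs, Algebra.algebraMap_eq_smul_one, norm_smul, hq]
    simp
  have hdu : diagForm 1 u = diagForm 1 v := by
    simp [diagForm, hu, norm_star_of_mul_star hK, hq]
  have hde : diagForm 1 e = diagForm 1 v := by
    rw [← Real.sq_sqrt hQ, ← hr, diagForm, Finset.sum_eq_single j]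
    · simp [he]
    · intro i _ hi
      simp [he, hi]
    · simp
  obtain ⟨R, hR, hRe⟩ := exists_reflection hK e u (hde.trans hdu.symm) (by
    rw [he, dotProduct_single, ← Pi.single_star, single_dotProduct, Pi.star_apply, huj,
      ← algebraMap_star_comm, ← algebraMap_star_comm, star_trivial, star_trivial]
    exact Algebra.commutes _ _)
  set D : Matrix (Fin N) (Fin N) K := Matrix.diagonal (fun _ => q) with hD
  have hDm : D ∈ unitary (Matrix (Fin N) (Fin N) K) := by
    rw [Unitary.mem_iff, Matrix.star_eq_conjTranspose, hD, Matrix.diagonal_conjTranspose,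
      Matrix.diagonal_mul_diagonal, Matrix.diagonal_mul_diagonal]
    simp [hsq, hqs]
  refine ⟨R * D, mul_mem hR hDm, ?_⟩
  rw [← Matrix.mulVec_mulVec]
  have hDe : D.mulVec e = MulOpposite.op q • e := by
    ext i
    rw [hD, Matrix.mulVec_diagonal, Pi.smul_apply, MulOpposite.smul_eq_mul_unop,
      MulOpposite.unop_op, he]
    rcases eq_or_ne i j with rfl | hij
    · simp [Algebra.commutes]
    · simp [hij]
  rw [hDe, Matrix.mulVec_smul, hRe]
  ext i
  simp [hu, mul_assoc, hsq]

end

/-! ### Haar integrals over compact groups -/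

section

variable {G : Type*} [Group G] [TopologicalSpace G] [IsTopologicalGroup G] [CompactSpace G]
  [MeasurableSpace G] [BorelSpace G]

instance instIsProbabilityMeasureHaarTop :
    IsProbabilityMeasure (Measure.haarMeasure (⊤ : TopologicalSpace.PositiveCompacts G)) :=
  ⟨by simpa using Measure.haarMeasure_self (K₀ := (⊤ : TopologicalSpace.PositiveCompacts G))⟩

/-- A right translate of Haar measure is still left invariant, hence a multiple of it, and total
mass one forces the factor to be `1`. -/
instance instIsMulRightInvariantHaarTop :
    (Measure.haarMeasure (⊤ : TopologicalSpace.PositiveCompacts G)).IsMulRightInvariant where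
  map_mul_right_eq_self g := by
    have : IsProbabilityMeasure (Measure.map (· * g)
        (Measure.haarMeasure (⊤ : TopologicalSpace.PositiveCompacts G))) :=
      Measure.isProbabilityMeasure_map (measurable_mul_const g).aemeasurable
    have h := Measure.isMulInvariant_eq_smul_of_compactSpace (Measure.map (· * g)
        (Measure.haarMeasure (⊤ : TopologicalSpace.PositiveCompacts G)))
        (Measure.haarMeasure (⊤ : TopologicalSpace.PositiveCompacts G))
    have h1 := congrArg (fun μ => μ Set.univ) h
    simp only [Measure.smul_apply, measure_univ, ENNReal.smul_def, smul_eq_mul, mul_one] at h1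
    rw [h, ENNReal.coe_eq_one.1 h1.symm, one_smul]

end

/-- Expansion of the exponential of a continuous function under an integral over a compact group. -/
theorem hasSum_integral_exp_of_continuous {G : Type*} [TopologicalSpace G] [CompactSpace G]
    [MeasurableSpace G] [BorelSpace G] (ν : Measure G) [IsProbabilityMeasure ν] {f : G → ℝ}
    (hf : Continuous f) (M : ℝ) :
    HasSum (fun n : ℕ => M ^ n / n.factorial * ∫ g, f g ^ n ∂ν) (∫ g, Real.exp (M * f g) ∂ν) := by
  obtain ⟨B, hB⟩ := (isCompact_range hf).isBounded.exists_norm_le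
  have hBg : ∀ g, ‖f g‖ ≤ B := fun g => hB _ (Set.mem_range_self g)
  have hint : ∀ F : G → ℝ, Continuous F → Integrable F ν := fun F hF => by
    obtain ⟨C, hC⟩ := (isCompact_range hF).isBounded.exists_norm_le
    exact .of_bound hF.stronglyMeasurable.aestronglyMeasurable C
      (.of_forall fun g => hC _ (Set.mem_range_self g))
  have hs : ∀ x : ℝ, HasSum (fun n : ℕ => x ^ n / n.factorial) (Real.exp x) := fun x => by
    rw [Real.exp_eq_exp_ℝ]
    exact NormedSpace.expSeries_div_hasSum_exp x
  have key := hasSum_integral_of_summable_integral_norm (μ := ν)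
    (F := fun (n : ℕ) g => (M * f g) ^ n / n.factorial)
    (fun n => hint _ (by fun_prop)) (by
      refine Summable.of_nonneg_of_le (fun n => integral_nonneg fun g => norm_nonneg _) (fun n => ?_)
        (hs (‖M‖ * B)).summable
      refine (integral_mono (g := fun _ => (‖M‖ * B) ^ n / n.factorial)
        (hint _ (by fun_prop)) (integrable_const _) fun g => ?_).trans (by simp)
      simp only [norm_div, norm_pow, norm_mul, Real.norm_natCast]
      gcongr
      exact hBg g)
  simp only [(hs _).tsum_eq] at key
  simp only [mul_pow, mul_div_right_comm, integral_const_mul] at key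
  exact key

/-! ### Moments of the entries of Haar distributed unitary matrices -/

/-- Supplies the integrable majorant for exchanging the Haar and Gaussian integrals. -/
theorem abs_diagForm_le {N : ℕ} {E : Type*} [NormedAddCommGroup E] (a : Fin N → ℝ) (v : Fin N → E) :
    |diagForm a v| ≤ (∑ i, |a i|) * diagForm 1 v := by
  rw [Finset.sum_mul]
  refine (Finset.abs_sum_le_sum_abs _ _).trans (Finset.sum_le_sum fun i _ => ?_)
  rw [abs_mul, abs_of_nonneg (sq_nonneg ‖v i‖)]
  refine mul_le_mul_of_nonneg_left ?_ (abs_nonneg _)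
  have := Finset.single_le_sum (f := fun i => (1 : Fin N → ℝ) i * ‖v i‖ ^ 2)
    (fun i _ => mul_nonneg zero_le_one (sq_nonneg _)) (Finset.mem_univ i)
  simpa only [Pi.one_apply, one_mul, diagForm] using this

section

variable {K : Type*} [NormedDivisionRing K] [NormedAlgebra ℝ K] [StarRing K] {N : ℕ}

/-- The action of a unitary matrix on column vectors, as a real linear equivalence. -/
def unitaryMulVec (g : unitary (Matrix (Fin N) (Fin N) K)) : (Fin N → K) ≃ₗ[ℝ] (Fin N → K) where
  toFun v := g.1.mulVec v
  map_add' v w := Matrix.mulVec_add _ v w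
  map_smul' r v := Matrix.mulVec_smul _ r v
  invFun v := (star g.1).mulVec v
  left_inv v := by simp [Matrix.mulVec_mulVec]
  right_inv v := by simp [Matrix.mulVec_mulVec]

section

variable [FiniteDimensional ℝ K] [MeasurableSpace K] [BorelSpace K] [SecondCountableTopology K]
  (μ : Measure K) [μ.IsAddHaarMeasure]

/-- A linear bijection scales Lebesgue measure by a constant. The Gaussian density is invariant and
has positive integral, so the constant is `1`; no determinant is computed. -/
theorem map_unitaryMulVec (hK : ∀ a : K, a * star a = algebraMap ℝ K (‖a‖ ^ 2))
    {m : ℕ} (hm : 0 < m) (hd : Module.finrank ℝ K = 2 * m)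
    (g : unitary (Matrix (Fin N) (Fin N) K)) :
    Measure.map (unitaryMulVec g) (Measure.pi fun _ => μ) = Measure.pi fun _ => μ := by
  have : ProperSpace K := FiniteDimensional.proper_real K
  set π : Measure (Fin N → K) := Measure.pi fun _ => μ with hπ
  have hcont : Continuous (unitaryMulVec g) :=
    (unitaryMulVec g).toLinearMap.continuous_of_finiteDimensional
  have h1 := Measure.map_linearMap_addHaar_eq_smul_addHaar π
    (LinearEquiv.isUnit_det' (unitaryMulVec g)).ne_zero
  set c := ENNReal.ofReal |(LinearMap.det (unitaryMulVec g : (Fin N → K) →ₗ[ℝ] _))⁻¹| with hc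
  change Measure.map (unitaryMulVec g) π = c • π at h1
  obtain ⟨b, hb, hJ⟩ := exists_integral_diagForm_pow_mul_exp (N := N) μ m hm hd
  have h0 := hJ 1 0
  have hcoeff : 0 < PowerSeries.coeff 0 (dirichletSeries m (1 : Fin N → ℝ)) := by
    simp [dirichletSeries]
  have h2 : ∫ v, Real.exp (-diagForm 1 v) ∂(Measure.map (unitaryMulVec g) π) =
      ∫ v, Real.exp (-diagForm 1 v) ∂π := by
    rw [integral_map hcont.aemeasurable (by
      exact (Real.continuous_exp.comp (continuous_diagForm 1).neg).aestronglyMeasurable)]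
    refine integral_congr_ae (.of_forall fun v => ?_)
    exact congrArg (fun x => Real.exp (-x)) (diagForm_one_mulVec hK (Unitary.mem_iff.1 g.2).1 v)
  simp only [pow_zero, one_mul, Nat.factorial_zero, Nat.cast_one] at h0
  rw [h1, integral_smul_measure, smul_eq_mul, h0] at h2
  have h3 : c.toReal = 1 := mul_right_cancel₀ (mul_pos hb hcoeff).ne' (h2.trans (one_mul _).symm)
  rw [h1, (ENNReal.toReal_eq_one_iff c).1 h3, one_smul]

theorem integral_comp_unitaryMulVec (hK : ∀ a : K, a * star a = algebraMap ℝ K (‖a‖ ^ 2))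
    {m : ℕ} (hm : 0 < m) (hd : Module.finrank ℝ K = 2 * m)
    (g : unitary (Matrix (Fin N) (Fin N) K)) {f : (Fin N → K) → ℝ} (hf : Continuous f) :
    ∫ v, f (g.1.mulVec v) ∂(Measure.pi fun _ => μ) = ∫ v, f v ∂(Measure.pi fun _ => μ) := by
  have hcont : Continuous (unitaryMulVec g) :=
    (unitaryMulVec g).toLinearMap.continuous_of_finiteDimensional
  nth_rewrite 2 [← map_unitaryMulVec μ hK hm hd g]
  rw [integral_map hcont.aemeasurable (by exact hf.aestronglyMeasurable)]
  rfl

end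

variable [StarModule ℝ K]
  [MeasurableSpace (unitary (Matrix (Fin N) (Fin N) K))]
  [BorelSpace (unitary (Matrix (Fin N) (Fin N) K))]
  (ν : Measure (unitary (Matrix (Fin N) (Fin N) K))) [ν.IsMulRightInvariant]

/-- By transitivity `v` is `h` applied to a real multiple of the `j`-th basis vector, and right
invariance removes `h`. -/
theorem integral_diagForm_mulVec_pow
    (hK : ∀ a : K, a * star a = algebraMap ℝ K (‖a‖ ^ 2))
    (a : Fin N → ℝ) (j : Fin N) (n : ℕ) (v : Fin N → K) :
    ∫ g, diagForm a (g.1.mulVec v) ^ n ∂ν =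
      diagForm 1 v ^ n * ∫ g, diagForm a (fun i => g.1 i j) ^ n ∂ν := by
  obtain ⟨h, hh, hv⟩ := exists_unitary_mulVec_single hK j v
  have hQ : 0 ≤ diagForm 1 v := Finset.sum_nonneg fun i _ => by simp
  set r := √(diagForm 1 v) with hr
  have h1 := integral_mul_right_eq_self (μ := ν)
    (fun g => diagForm a (g.1.mulVec (Pi.single j (algebraMap ℝ K r))) ^ n) ⟨h, hh⟩
  have h2 : ∀ g : Matrix (Fin N) (Fin N) K,
      diagForm a (g.mulVec (Pi.single j (algebraMap ℝ K r))) =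
        diagForm 1 v * diagForm a (fun i => g i j) := fun g => by
    rw [diagForm, diagForm.eq_1 a, Finset.mul_sum]
    refine Finset.sum_congr rfl fun i _ => ?_
    have : g.mulVec (Pi.single j (algebraMap ℝ K r)) i = g i j * algebraMap ℝ K r := by
      simp [Matrix.mulVec, dotProduct_single]
    rw [this, norm_mul, norm_algebraMap', mul_pow, Real.norm_eq_abs, sq_abs, hr, Real.sq_sqrt hQ]
    ring
  simp only [Submonoid.coe_mul, ← Matrix.mulVec_mulVec, hv] at h1
  simp only [h1, h2, mul_pow, integral_const_mul]

/-- The Gaussian moment of the form `a`, averaged over rotations, equals the column moment times the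
Gaussian moment of `‖v‖²`. The latter is the case `a = 1`, whose coefficient is the binomial. -/
theorem integral_diagForm_column_pow [FiniteDimensional ℝ K] [IsProbabilityMeasure ν]
    (hK : ∀ a : K, a * star a = algebraMap ℝ K (‖a‖ ^ 2))
    {m : ℕ} (hm : 0 < m) (hd : Module.finrank ℝ K = 2 * m) (a : Fin N → ℝ) (j : Fin N) (n : ℕ) :
    (∫ g, diagForm a (fun i => g.1 i j) ^ n ∂ν) * (m * N - 1 + n).choose (m * N - 1) =
      PowerSeries.coeff n (dirichletSeries m a) := by
  borelize K
  have : ProperSpace K := FiniteDimensional.proper_real K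
  set μ : Measure K := Measure.addHaar
  obtain ⟨c, hc, hJ⟩ := exists_integral_diagForm_pow_mul_exp (N := N) μ m hm hd
  set π : Measure (Fin N → K) := Measure.pi fun _ => μ with hπ
  have hcont : Continuous fun x : unitary (Matrix (Fin N) (Fin N) K) × (Fin N → K) =>
      x.1.1.mulVec x.2 :=
    Continuous.matrix_mulVec (continuous_subtype_val.comp continuous_fst) continuous_snd
  have hint : Integrable (Function.uncurry
      fun (g : unitary (Matrix (Fin N) (Fin N) K)) (v : Fin N → K) =>
        diagForm a (g.1.mulVec v) ^ n * Real.exp (-diagForm 1 v)) (ν.prod π) := by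
    refine Integrable.mono' (((integrable_diagForm_pow_mul_exp μ m hm hd 1 n).const_mul
      ((∑ i, |a i|) ^ n)).comp_snd ν) ?_ (.of_forall fun x => ?_)
    · refine Continuous.aestronglyMeasurable ?_
      exact (((continuous_diagForm a).comp hcont).pow n).mul
        (Real.continuous_exp.comp ((continuous_diagForm 1).comp continuous_snd).neg)
    · rw [Function.uncurry, norm_mul, Real.norm_of_nonneg (Real.exp_pos _).le, ← mul_assoc,
        ← mul_pow, norm_pow, Real.norm_eq_abs]
      gcongr
      rw [← diagForm_one_mulVec hK (Unitary.mem_iff.1 x.1.2).1 x.2]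
      exact abs_diagForm_le _ _
  have h1 : ∫ g, ∫ v, diagForm a (g.1.mulVec v) ^ n * Real.exp (-diagForm 1 v) ∂π ∂ν =
      ∫ v, diagForm a v ^ n * Real.exp (-diagForm 1 v) ∂π := by
    have : ∀ g : unitary (Matrix (Fin N) (Fin N) K),
        ∫ v, diagForm a (g.1.mulVec v) ^ n * Real.exp (-diagForm 1 v) ∂π =
          ∫ v, diagForm a v ^ n * Real.exp (-diagForm 1 v) ∂π := fun g => by
      rw [hπ, ← integral_comp_unitaryMulVec μ hK hm hd g (f := fun v =>
        diagForm a v ^ n * Real.exp (-diagForm 1 v)) (((continuous_diagForm a).pow n).mul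
        (Real.continuous_exp.comp (continuous_diagForm 1).neg))]
      simp only [diagForm_one_mulVec hK (Unitary.mem_iff.1 g.2).1]
    simp [this]
  rw [integral_integral_swap hint] at h1
  simp only [integral_mul_const, integral_diagForm_mulVec_pow ν hK a j n] at h1
  have h2 : ∀ v : Fin N → K, diagForm 1 v ^ n * (∫ g, diagForm a (fun i => g.1 i j) ^ n ∂ν) *
      Real.exp (-diagForm 1 v) = (∫ g, diagForm a (fun i => g.1 i j) ^ n ∂ν) *
        (diagForm 1 v ^ n * Real.exp (-diagForm 1 v)) := fun v => by ring
  simp only [h2, integral_const_mul] at h1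
  rw [hJ, hJ, coeff_dirichletSeries_one m hm (Fin.pos j)] at h1
  have hn : (n.factorial : ℝ) ≠ 0 := by positivity
  refine mul_left_cancel₀ (mul_ne_zero hc.ne' hn) ?_
  linear_combination h1

end

/-! ### The spectral theorem for quaternionic Hermitian matrices -/

section

variable {N : ℕ}

theorem quaternion_mul_star_self (a : ℍ) : a * star a = algebraMap ℝ ℍ (‖a‖ ^ 2) := by
  rw [Quaternion.self_mul_star, Quaternion.normSq_eq_norm_mul_self, sq]
  rfl

instance instStarModuleQuaternion : StarModule ℝ ℍ :=
  ⟨fun r a => by rw [Quaternion.star_smul, star_trivial r]⟩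

theorem inner_toLp_quaternion (v w : Fin N → ℍ) :
    inner ℝ (WithLp.toLp 2 v) (WithLp.toLp 2 w) = (star w ⬝ᵥ v).re := by
  have hre : ∀ f : Fin N → ℍ, (∑ i, f i).re = ∑ i, (f i).re := fun f =>
    map_sum (QuaternionAlgebra.reₗ (-1 : ℝ) 0 (-1)) f Finset.univ
  rw [PiLp.inner_apply, dotProduct, hre]
  refine Finset.sum_congr rfl fun i _ => ?_
  rw [Quaternion.inner_def, Pi.star_apply, Quaternion.re_mul, Quaternion.re_mul]
  ring

theorem star_mulVec_dotProduct {X : Matrix (Fin N) (Fin N) ℍ} (hX : X.IsHermitian)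
    (v w : Fin N → ℍ) : star (X.mulVec v) ⬝ᵥ w = star v ⬝ᵥ X.mulVec w := by
  rw [Matrix.star_mulVec, hX.eq, Matrix.dotProduct_mulVec]

/-- A quaternionic matrix acting on column vectors, as a real linear map of a Euclidean space. -/
def quaternionToLin (X : Matrix (Fin N) (Fin N) ℍ) :
    PiLp 2 (fun _ : Fin N => ℍ) →ₗ[ℝ] PiLp 2 (fun _ : Fin N => ℍ) where
  toFun v := WithLp.toLp 2 (X.mulVec (WithLp.ofLp v))
  map_add' v w := by simp [Matrix.mulVec_add]
  map_smul' r v := by simp [Matrix.mulVec_smul]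

theorem isSymmetric_quaternionToLin {X : Matrix (Fin N) (Fin N) ℍ} (hX : X.IsHermitian) :
    (quaternionToLin X).IsSymmetric := by
  intro v w
  change inner ℝ (WithLp.toLp 2 (X.mulVec (WithLp.ofLp v))) (WithLp.toLp 2 (WithLp.ofLp w)) =
    inner ℝ (WithLp.toLp 2 (WithLp.ofLp v)) (WithLp.toLp 2 (X.mulVec (WithLp.ofLp w)))
  rw [inner_toLp_quaternion, inner_toLp_quaternion, star_mulVec_dotProduct hX]

/-- The vectors orthogonal to the given eigenvectors form an `X`-invariant real subspace, nonzero
because `4 * k < 4 * N`. There `X` acts as a real symmetric operator, which has a real eigenvalue.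
-/
theorem exists_unit_eigenvector_orthogonal {X : Matrix (Fin N) (Fin N) ℍ} (hX : X.IsHermitian)
    {k : ℕ} (hk : k < N) (v : Fin k → Fin N → ℍ) (l : Fin k → ℝ)
    (hv : ∀ i, X.mulVec (v i) = l i • v i) :
    ∃ (w : Fin N → ℍ) (r : ℝ), X.mulVec w = r • w ∧ star w ⬝ᵥ w = 1 ∧
      ∀ i, star (v i) ⬝ᵥ w = 0 := by
  let L : PiLp 2 (fun _ : Fin N => ℍ) →ₗ[ℝ] (Fin k → ℍ) :=
    { toFun := fun w i => star (v i) ⬝ᵥ WithLp.ofLp w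
      map_add' := fun w w' => by ext1 i; simp [dotProduct_add]
      map_smul' := fun r w => by ext1 i; simp [dotProduct_smul] }
  have hdim : Module.finrank ℝ (Fin k → ℍ) <
      Module.finrank ℝ (PiLp 2 (fun _ : Fin N => ℍ)) := by
    rw [(WithLp.linearEquiv 2 ℝ (Fin N → ℍ)).finrank_eq, Module.finrank_pi_fintype,
      Module.finrank_pi_fintype]
    simp [Quaternion.finrank_eq_four, hk]
  have hW := LinearMap.ker_ne_bot_of_finrank_lt (f := L) hdim
  have : Nontrivial L.ker := Submodule.nontrivial_iff_ne_bot.2 hW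
  have hinv : ∀ w ∈ L.ker, quaternionToLin X w ∈ L.ker := fun w hw => by
    rw [LinearMap.mem_ker] at hw ⊢
    ext1 i
    have hi : star (v i) ⬝ᵥ WithLp.ofLp w = 0 := congrFun hw i
    change star (v i) ⬝ᵥ X.mulVec (WithLp.ofLp w) = 0
    rw [← star_mulVec_dotProduct hX, hv, star_smul, smul_dotProduct, hi, smul_zero]
  obtain ⟨w, hw⟩ := ((isSymmetric_quaternionToLin hX).restrict_invariant
    hinv).hasEigenvalue_iSup_of_finiteDimensional.exists_hasEigenvector
  set r : ℝ := _
  obtain ⟨hwm, hw0⟩ := hw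
  have h1 := congrArg (fun z : L.ker => WithLp.ofLp z.1) (Module.End.mem_eigenspace_iff.1 hwm)
  set u : Fin N → ℍ := WithLp.ofLp w.1 with hu
  have h2 : X.mulVec u = r • u := h1
  have hu0 : u ≠ 0 := fun h => hw0 (Subtype.ext ((WithLp.ofLp_injective 2) h))
  have hQ0 : 0 ≤ diagForm 1 u := Finset.sum_nonneg fun i _ => by simp
  have hQ : diagForm 1 u ≠ 0 := fun h => hu0 <| by
    ext1 i
    have h3 := (Finset.sum_eq_zero_iff_of_nonneg
      (fun i _ => mul_nonneg zero_le_one (sq_nonneg _))).1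
      (h : ∑ i, (1 : Fin N → ℝ) i * ‖u i‖ ^ 2 = 0) i (Finset.mem_univ i)
    simpa using h3
  refine ⟨(√(diagForm 1 u))⁻¹ • u, r, ?_, ?_, fun i => ?_⟩
  · rw [Matrix.mulVec_smul, h2, smul_comm]
  · rw [star_smul, smul_dotProduct, dotProduct_smul, star_dotProduct_self quaternion_mul_star_self,
      star_trivial, smul_smul, ← mul_inv, Real.mul_self_sqrt hQ0, Algebra.smul_def, ← map_mul,
      inv_mul_cancel₀ hQ, map_one]
  · have h3 : star (v i) ⬝ᵥ u = 0 := congrFun (LinearMap.mem_ker.1 w.2) i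
    rw [dotProduct_smul, h3, smul_zero]

theorem exists_orthonormal_eigenvectors {X : Matrix (Fin N) (Fin N) ℍ} (hX : X.IsHermitian)
    (k : ℕ) (hk : k ≤ N) :
    ∃ (v : Fin k → Fin N → ℍ) (l : Fin k → ℝ), (∀ i, X.mulVec (v i) = l i • v i) ∧
      ∀ i j, star (v i) ⬝ᵥ v j = if i = j then 1 else 0 := by
  induction k with
  | zero => exact ⟨Fin.elim0, Fin.elim0, fun i => i.elim0, fun i => i.elim0⟩
  | succ k ih =>
    obtain ⟨v, l, hv, ho⟩ := ih (by omega)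
    obtain ⟨w, r, hw, hww, hvw⟩ := exists_unit_eigenvector_orthogonal hX (by omega) v l hv
    have hwv : ∀ i, star w ⬝ᵥ v i = 0 := fun i => by
      rw [Matrix.star_dotProduct, hvw, star_zero]
    refine ⟨Fin.cons w v, Fin.cons r l, fun i => ?_, fun i j => ?_⟩
    · refine Fin.cases ?_ (fun i => ?_) i <;> simp [hw, hv]
    · refine Fin.cases ?_ (fun i => ?_) i <;> refine Fin.cases ?_ (fun j => ?_) j <;>
        simp [hww, hvw, hwv, ho, Fin.succ_ne_zero, (Fin.succ_ne_zero _).symm]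

/-- A quaternionic Hermitian matrix is diagonalized by an element of `Sp(N)`. -/
theorem exists_unitary_mul_diagonal {X : Matrix (Fin N) (Fin N) ℍ} (hX : X.IsHermitian) :
    ∃ U ∈ Sp N, ∃ l : Fin N → ℝ, X * U = U * Matrix.diagonal fun i => algebraMap ℝ ℍ (l i) := by
  obtain ⟨v, l, hv, ho⟩ := exists_orthonormal_eigenvectors hX N le_rfl
  have h1 : star (Matrix.of fun i j => v j i) * (Matrix.of fun i j => v j i) = 1 := by
    ext1 i j
    rw [Matrix.one_apply, ← ho i j]
    rfl
  refine ⟨Matrix.of fun i j => v j i, Unitary.mem_iff.2 ⟨h1, mul_eq_one_comm.1 h1⟩, l, ?_⟩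
  ext1 i j
  rw [Matrix.mul_diagonal, ← Algebra.commutes, ← Algebra.smul_def]
  exact congrFun (hv j) i

theorem finrank_mulOpposite_self : Module.finrank ℍᵐᵒᵖ ℍ = 1 := by
  refine finrank_eq_one (1 : ℍ) one_ne_zero fun w => ⟨MulOpposite.op w, ?_⟩
  simp

/-- In the coordinates `star U * w` the eigenspace consists of the vectors supported where `l i =
r`. -/
theorem finrank_eigenspace_of_diagonal {X U : Matrix (Fin N) (Fin N) ℍ} (hU : U ∈ Sp N)
    {l : Fin N → ℝ} (h : X * U = U * Matrix.diagonal fun i => algebraMap ℝ ℍ (l i)) (r : ℝ) :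
    Module.finrank ℍᵐᵒᵖ (eigenspace X r) = Fintype.card {i // l i = r} := by
  obtain ⟨h1, h2⟩ := Unitary.mem_iff.1 hU
  set D : Matrix (Fin N) (Fin N) ℍ := Matrix.diagonal fun i => algebraMap ℝ ℍ (l i) with hD
  have hUX : star U * X = D * star U := by
    rw [← mul_one (star U * X), ← h2, ← mul_assoc, mul_assoc (star U), h, ← mul_assoc, h1, one_mul]
  have hDv : ∀ c i, D.mulVec c i = l i • c i := fun c i => by
    rw [hD, Matrix.mulVec_diagonal, Algebra.smul_def]
  have hvan : ∀ w ∈ eigenspace X r, ∀ i, l i ≠ r → (star U).mulVec w i = 0 := by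
    intro w hw i hi
    have h3 : X.mulVec w = r • w := hw
    have h4 := congrFun (congrArg (star U).mulVec h3) i
    rw [Matrix.mulVec_mulVec, hUX, ← Matrix.mulVec_mulVec, hDv, Matrix.mulVec_smul,
      Pi.smul_apply, ← sub_eq_zero, ← sub_smul] at h4
    exact (smul_eq_zero.1 h4).resolve_left (sub_ne_zero.2 hi)
  let ext0 : ({i // l i = r} → ℍ) → Fin N → ℍ := fun c i => if hi : l i = r then c ⟨i, hi⟩ else 0
  have hmem : ∀ c, U.mulVec (ext0 c) ∈ eigenspace X r := fun c => by
    change X.mulVec (U.mulVec (ext0 c)) = r • U.mulVec (ext0 c)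
    rw [Matrix.mulVec_mulVec, h, ← Matrix.mulVec_mulVec, ← Matrix.mulVec_smul]
    congr 1
    ext1 i
    rw [hDv, Pi.smul_apply]
    by_cases hi : l i = r
    · rw [hi]
    · simp [ext0, hi]
  let e : eigenspace X r ≃ₗ[ℍᵐᵒᵖ] ({i // l i = r} → ℍ) :=
    { toFun := fun w i => (star U).mulVec w.1 i
      map_add' := fun w w' => by ext1 i; simp [Matrix.mulVec_add]
      map_smul' := fun q w => by ext1 i; simp [Matrix.mulVec_smul]
      invFun := fun c => ⟨U.mulVec (ext0 c), hmem c⟩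
      left_inv := fun w => by
        apply Subtype.ext
        have h5 : ext0 (fun i => (star U).mulVec w.1 i) = (star U).mulVec w.1 := by
          ext1 i
          by_cases hi : l i = r
          · simp [ext0, hi]
          · simp only [ext0, hi, dif_neg, not_false_eq_true, hvan w.1 w.2 i hi]
        simp only [h5]
        rw [Matrix.mulVec_mulVec, h2, Matrix.one_mulVec]
      right_inv := fun c => by
        ext1 i
        simp only [Matrix.mulVec_mulVec, h1, Matrix.one_mulVec]
        simp [ext0, i.2] }
  have : Module.Finite ℍᵐᵒᵖ ℍ := Module.finite_of_finrank_eq_succ finrank_mulOpposite_self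
  rw [e.finrank_eq, Module.finrank_pi_fintype]
  simp [finrank_mulOpposite_self]

/-- A quaternionic Hermitian matrix is unitarily equivalent to the diagonal matrix of its
eigenvalues, in any order. -/
theorem IsEigenvalueList.exists_unitary {X : Matrix (Fin N) (Fin N) ℍ} (hX : X.IsHermitian)
    {x : Fin N → ℝ} (hx : IsEigenvalueList X x) :
    ∃ U ∈ Sp N, X = U * (Matrix.diagonal fun i => algebraMap ℝ ℍ (x i)) * star U := by
  obtain ⟨U, hU, l, h⟩ := exists_unitary_mul_diagonal hX
  have hcard : ∀ r, Fintype.card {i // x i = r} = Fintype.card {i // l i = r} := fun r => by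
    rw [← finrank_eigenspace_of_diagonal hU h, hx r, Fintype.card_subtype]
  -- Equal multiplicities make the two lists permutations of each other; `σ` then reorders the
  -- columns of `U`.
  let σ : Fin N ≃ Fin N := Equiv.ofFiberEquiv fun r => Fintype.equivOfCardEq (hcard r)
  have hσ : ∀ i, l (σ i) = x i := Equiv.ofFiberEquiv_map _
  obtain ⟨h1, h2⟩ := Unitary.mem_iff.1 hU
  have hX' : X = U * (Matrix.diagonal fun i => algebraMap ℝ ℍ (l i)) * star U := by
    rw [← h, mul_assoc, h2, mul_one]
  have hs : star (U.submatrix id σ) = (star U).submatrix σ id := rfl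
  refine ⟨U.submatrix id σ, Unitary.mem_iff.2 ⟨?_, ?_⟩, ?_⟩
  · rw [hs, ← Matrix.submatrix_mul _ _ _ _ _ Function.bijective_id, h1,
      Matrix.submatrix_one_equiv]
  · rw [hs, Matrix.submatrix_mul_equiv, h2, Matrix.submatrix_id_id]
  · have hd : (Matrix.diagonal fun i => algebraMap ℝ ℍ (x i)) =
        (Matrix.diagonal fun i => algebraMap ℝ ℍ (l i)).submatrix σ σ := by
      rw [Matrix.submatrix_diagonal_equiv]
      simp [Function.comp_def, hσ]
    rw [hs, hd, Matrix.submatrix_mul_equiv, Matrix.submatrix_mul_equiv, Matrix.submatrix_id_id, hX']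

end

/-! ### The rank one integral for diagonal matrices -/

theorem haarIntegral_mul_left_mul_right {G : Type*} [Group G] [TopologicalSpace G]
    [IsTopologicalGroup G] [CompactSpace G] (f : G → ℂ) (u v : G) :
    haarIntegral G (fun g => f (u * g * v)) = haarIntegral G f := by
  borelize G
  unfold haarIntegral
  rw [integral_mul_left_eq_self (fun g => f (g * v)) u, integral_mul_right_eq_self f v]

section

variable {N : ℕ}

open PowerSeries in
/-- The moments of a rational function with all poles of the same order `m`. -/
theorem poleMoment_nsmul {γ : ℝ → ℂ} (hγ : IsClosedContour γ) {m : ℕ} (hm : 0 < m) (hN : 0 < N)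
    (a : Fin N → ℝ) (ha : ∀ i, Encloses γ (a i : ℂ)) :
    PowerSeries.mk (poleMoment γ (m • Finset.univ.val.map fun i => (a i : ℂ))) =
      X ^ (m * N - 1) * (dirichletSeries m a).map (algebraMap ℝ ℂ) := by
  have hpos := Nat.mul_pos hm hN
  have h1 := mk_poleMoment_mul_prod hγ (m * N - 1) (m • Finset.univ.val.map fun i => (a i : ℂ))
    (by simp [Nat.sub_add_cancel hpos]) (fun b hb => by
      obtain ⟨i, -, rfl⟩ := Multiset.mem_map.1 (Multiset.mem_of_mem_nsmul hb)
      exact ha i)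
  have h2 := congrArg (PowerSeries.map (algebraMap ℝ ℂ)) (dirichletSeries_mul_prod m hm a)
  have h3 : (((m • Finset.univ.val.map fun i => (a i : ℂ)).map fun b => 1 - C b * X).prod) =
      PowerSeries.map (algebraMap ℝ ℂ) (∏ i, (1 - C (a i) * X) ^ m) := by
    rw [Multiset.map_nsmul, Multiset.prod_nsmul, Multiset.map_map, Finset.prod_pow, map_pow,
      map_prod]
    refine congrArg (· ^ m) (Finset.prod_congr rfl fun i _ => ?_)
    simp
  rw [map_mul, map_one, ← h3] at h2
  rw [← h1, mul_assoc, mul_comm _ (PowerSeries.map _ _), h2, mul_one]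

theorem poleProd_nsmul (m : ℕ) (a : Fin N → ℝ) (t : ℂ) :
    poleProd (m • Finset.univ.val.map fun i => (a i : ℂ)) t = ∏ i, ((t - (a i : ℂ)) ^ m)⁻¹ := by
  rw [poleProd, Multiset.map_nsmul, Multiset.prod_nsmul, Multiset.map_map, Finset.prod_inv_distrib,
    Finset.prod_pow, ← inv_pow, ← Finset.prod_inv_distrib]
  rfl

variable {K : Type*} [NormedDivisionRing K] [NormedAlgebra ℝ K] [StarRing K]

/-- The rank one diagonal matrix selects column `j` of `h`. -/
theorem trace_diagonal_mul_mul_diagonal_single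
    (hK : ∀ a : K, a * star a = algebraMap ℝ K (‖a‖ ^ 2)) (x : Fin N → ℝ) (j : Fin N) (y : ℝ)
    (h : Matrix (Fin N) (Fin N) K) :
    ((Matrix.diagonal fun i => algebraMap ℝ K (x i)) * h *
      (Matrix.diagonal fun i => algebraMap ℝ K ((Pi.single j y : Fin N → ℝ) i)) * star h).trace =
      algebraMap ℝ K (diagForm (fun i => x i * y) fun i => h i j) := by
  rw [Matrix.trace, diagForm, map_sum]
  refine Finset.sum_congr rfl fun i _ => ?_
  rw [Matrix.diag_apply, Matrix.mul_apply, Finset.sum_eq_single j]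
  · rw [Matrix.mul_diagonal, Matrix.diagonal_mul, Pi.single_eq_same, Matrix.star_apply, mul_assoc,
      mul_assoc, Algebra.left_comm, hK, ← map_mul, ← map_mul]
    congr 1
    ring
  · intro k _ hk
    rw [Matrix.mul_diagonal, Pi.single_eq_of_ne hk, map_zero, mul_zero, zero_mul]
  · simp

variable [StarModule ℝ K] [FiniteDimensional ℝ K] [ContinuousStar K]
  [CompactSpace (unitary (Matrix (Fin N) (Fin N) K))]

theorem haarIntegral_exp_diagForm (hK : ∀ a : K, a * star a = algebraMap ℝ K (‖a‖ ^ 2))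
    {m : ℕ} (hm : 0 < m) (hd : Module.finrank ℝ K = 2 * m) (a : Fin N → ℝ) (j : Fin N)
    {M : ℝ} (hM : M ≠ 0) {γ : ℝ → ℂ} (hγ : IsClosedContour γ)
    (ha : ∀ i, Encloses γ (a i : ℂ)) :
    haarIntegral (unitary (Matrix (Fin N) (Fin N) K))
        (fun g => Complex.exp ((M * diagForm a (fun i => g.1 i j) : ℝ) : ℂ)) =
      ((m * N - 1).factorial : ℂ) / (M : ℂ) ^ (m * N - 1) *
        ((2 * Real.pi * Complex.I)⁻¹ * contourIntegral γ (fun t => Complex.exp (M * t) *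
          ∏ i, ((t - (a i : ℂ)) ^ m)⁻¹)) := by
  borelize ↥(unitary (Matrix (Fin N) (Fin N) K))
  set ν : Measure (unitary (Matrix (Fin N) (Fin N) K)) :=
    Measure.haarMeasure (⊤ : TopologicalSpace.PositiveCompacts _) with hν
  have hN : 0 < N := Fin.pos j
  set p := m * N - 1 with hp
  have hcont : Continuous fun g : unitary (Matrix (Fin N) (Fin N) K) =>
      diagForm a (fun i => g.1 i j) :=
    (continuous_diagForm a).comp (continuous_pi fun i =>
      (continuous_apply_apply i j).comp continuous_subtype_val)
  have h1 := hasSum_integral_exp_of_continuous ν hcont M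
  have h2 : haarIntegral (unitary (Matrix (Fin N) (Fin N) K))
        (fun g => Complex.exp ((M * diagForm a (fun i => g.1 i j) : ℝ) : ℂ)) =
      ((∫ g, Real.exp (M * diagForm a (fun i => g.1 i j)) ∂ν : ℝ) : ℂ) := by
    unfold haarIntegral
    rw [← integral_complex_ofReal]
    simp only [Complex.ofReal_exp]
    rfl
  have h3 := hasSum_poleMoment_exp (A := m • Finset.univ.val.map fun i => (a i : ℂ)) hγ
    (fun b hb => by
      obtain ⟨i, -, rfl⟩ := Multiset.mem_map.1 (Multiset.mem_of_mem_nsmul hb)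
      exact ha i) M
  simp only [poleProd_nsmul] at h3
  have h4 : ∀ k, poleMoment γ (m • Finset.univ.val.map fun i => (a i : ℂ)) k = _ := fun k => by
    rw [← PowerSeries.coeff_mk k (poleMoment γ _), poleMoment_nsmul hγ hm hN a ha,
      PowerSeries.coeff_X_pow_mul']
  -- The factor `X ^ p` kills the first `p` moments, so term `n` on the group side matches term `n +
  -- p` here.
  have h5 := (hasSum_nat_add_iff' p).2 h3
  rw [Finset.sum_eq_zero (fun k hk => by
    rw [h4, if_neg (not_le.2 (Finset.mem_range.1 hk)), mul_zero]), sub_zero] at h5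
  have h6 := h5.mul_left ((p.factorial : ℂ) / (M : ℂ) ^ p)
  have h7 := (Complex.hasSum_ofReal (f := _)).2 h1
  rw [h2]
  refine h7.unique ?_
  refine Eq.mpr (congrArg (HasSum · _) (funext fun n => ?_)) h6
  have hMc : (M : ℂ) ≠ 0 := Complex.ofReal_ne_zero.2 hM
  have h8 := integral_diagForm_column_pow ν hK hm hd a j n
  have h9 : ((p + n).choose p : ℂ) * p.factorial * n.factorial = (p + n).factorial := by
    have := Nat.choose_mul_factorial_mul_factorial (Nat.le_add_right p n)
    rw [Nat.add_sub_cancel_left] at this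
    exact_mod_cast this
  rw [h4, if_pos (by omega), Nat.add_sub_cancel, PowerSeries.coeff_map, ← h8, add_comm n p, ← h9]
  have hc : ((p + n).choose p : ℂ) ≠ 0 :=
    Nat.cast_ne_zero.2 (Nat.choose_pos (Nat.le_add_right p n)).ne'
  have hf1 : (p.factorial : ℂ) ≠ 0 := Nat.cast_ne_zero.2 p.factorial_ne_zero
  have hf2 : (n.factorial : ℂ) ≠ 0 := Nat.cast_ne_zero.2 n.factorial_ne_zero
  simp only [Complex.coe_algebraMap, Complex.ofReal_mul, Complex.ofReal_div, Complex.ofReal_pow,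
    Complex.ofReal_natCast]
  rw [← hp]
  field_simp
  ring

end

/-- Over ℍ the trace itself is not cyclic; its real part is, because `re (a * b) = re (b * a)`. -/
theorem quaternion_re_trace_mul_comm {N : ℕ} (A B : Matrix (Fin N) (Fin N) ℍ) :
    (A * B).trace.re = (B * A).trace.re := by
  have hre : ∀ f : Fin N → ℍ, (∑ i, f i).re = ∑ i, (f i).re := fun f =>
    map_sum (QuaternionAlgebra.reₗ (-1 : ℝ) 0 (-1)) f Finset.univ
  simp only [Matrix.trace, Matrix.diag_apply, Matrix.mul_apply, hre]
  rw [Finset.sum_comm]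
  refine Finset.sum_congr rfl fun i _ => Finset.sum_congr rfl fun k _ => ?_
  rw [Quaternion.re_mul, Quaternion.re_mul]
  ring

/-- Collects both diagonalizing unitaries into `star U * g * V`; the outer conjugation by `U`
disappears under the trace. -/
theorem conj_mul_mul_conj {R : Type*} [Ring R] [StarRing R] {U V : R} (hU : U * star U = 1)
    (A B g : R) :
    U * A * star U * g * (V * B * star V) * star g =
      U * (A * (star U * g * V) * B * star (star U * g * V) * star U) := by
  simp only [star_mul, star_star, mul_assoc, hU, mul_one]

theorem star_mul_conj {R : Type*} [Ring R] [StarRing R] {U : R} (hU : star U * U = 1) (A : R) :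
    A * star U * U = A := by rw [mul_assoc, hU, mul_one]

end RankOneIntegral

end

theorem mainTheorem8 (N : ℕ) (M : ℝ) (hM : M ≠ 0) :
    (∀ (X Y : Matrix (Fin N) (Fin N) ℂ) (hX : X.IsHermitian) (hY : Y.IsHermitian)
      (j : Fin N) (y : ℝ), hY.eigenvalues = Pi.single j y →
      ∀ γ : ℝ → ℂ, IsClosedContour γ →
        (∀ i, Encloses γ ((hX.eigenvalues i * y : ℝ) : ℂ)) →
        haarIntegral (Matrix.unitaryGroup (Fin N) ℂ)
            (fun g => Complex.exp (M * (X * g.1 * Y * g.1.conjTranspose).trace)) =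
          ((N - 1).factorial : ℂ) / (M : ℂ) ^ (N - 1) *
            ((2 * Real.pi * Complex.I)⁻¹ * contourIntegral γ (fun t => Complex.exp (M * t) *
              ∏ i, (t - ((hX.eigenvalues i * y : ℝ) : ℂ))⁻¹))) ∧
    (∀ (X Y : Matrix (Fin N) (Fin N) ℍ[ℝ]), X.IsHermitian → Y.IsHermitian →
      ∀ (x : Fin N → ℝ), IsEigenvalueList X x →
      ∀ (j : Fin N) (y : ℝ), IsEigenvalueList Y (Pi.single j y) →
      ∀ γ : ℝ → ℂ, IsClosedContour γ →
        (∀ i, Encloses γ ((x i * y : ℝ) : ℂ)) →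
        haarIntegral (Sp N)
            (fun g => Complex.exp ((M * (X * g.1 * Y * (g⁻¹).1).trace.re : ℝ) : ℂ)) =
          ((2 * N - 1).factorial : ℂ) / (M : ℂ) ^ (2 * N - 1) *
            ((2 * Real.pi * Complex.I)⁻¹ * contourIntegral γ (fun t => Complex.exp (M * t) *
              ∏ i, ((t - ((x i * y : ℝ) : ℂ)) ^ 2)⁻¹))) := by
  constructor
  · intro X Y hX hY j y hy γ hγ hE
    have hK : ∀ a : ℂ, a * star a = algebraMap ℝ ℂ (‖a‖ ^ 2) := fun a => by
      simpa using Complex.mul_conj' a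
    -- The case `m = 1`.
    have key := haarIntegral_exp_diagForm hK one_pos (by simp) _ j hM hγ hE
    simp only [one_mul, pow_one] at key
    rw [← key]
    refine Eq.trans (congrArg _ (funext fun g => ?_)) (haarIntegral_mul_left_mul_right
      (fun g : unitary (Matrix (Fin N) (Fin N) ℂ) => Complex.exp
        ((M * diagForm (fun i => hX.eigenvalues i * y) (fun i => g.1 i j) : ℝ) : ℂ))
      (star hX.eigenvectorUnitary) hY.eigenvectorUnitary)
    have hXs := hX.spectral_theorem
    have hYs := hY.spectral_theorem
    rw [hy] at hYs
    rw [Unitary.conjStarAlgAut_apply] at hXs hYs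
    have h1 := congrArg Matrix.trace (conj_mul_mul_conj
      (Unitary.mem_iff.1 hX.eigenvectorUnitary.2).2
      (Matrix.diagonal fun i => algebraMap ℝ ℂ (hX.eigenvalues i))
      (Matrix.diagonal fun i => algebraMap ℝ ℂ ((Pi.single j y : Fin N → ℝ) i)) g.1
      (V := hY.eigenvectorUnitary.1))
    rw [Matrix.trace_mul_comm _ (_ * star hX.eigenvectorUnitary.1),
      star_mul_conj (Unitary.mem_iff.1 hX.eigenvectorUnitary.2).1,
      trace_diagonal_mul_mul_diagonal_single hK] at h1
    have h2 : (X * g.1 * Y * g.1.conjTranspose).trace = _ :=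
      (congrArg₂ (fun A B => (A * g.1 * B * star g.1).trace) hXs hYs).trans h1
    rw [h2, Complex.ofReal_mul]
    rfl
  · intro X Y hX hY x hx j y hy γ hγ hE
    -- The case `m = 2`: real dimension `4 = 2 * 2` makes the poles double.
    have key := haarIntegral_exp_diagForm quaternion_mul_star_self two_pos
      Quaternion.finrank_eq_four _ j hM hγ hE
    obtain ⟨U, hU, hXs⟩ := hx.exists_unitary hX
    obtain ⟨V, hV, hYs⟩ := hy.exists_unitary hY
    rw [← key]
    refine Eq.trans (congrArg _ (funext fun g => ?_)) (haarIntegral_mul_left_mul_right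
      (fun g : Sp N => Complex.exp
        ((M * diagForm (fun i => x i * y) (fun i => g.1 i j) : ℝ) : ℂ))
      (star ⟨U, hU⟩) ⟨V, hV⟩)
    have h1 := congrArg (fun A => A.trace.re) (conj_mul_mul_conj (Unitary.mem_iff.1 hU).2
      (Matrix.diagonal fun i => algebraMap ℝ ℍ (x i))
      (Matrix.diagonal fun i => algebraMap ℝ ℍ ((Pi.single j y : Fin N → ℝ) i)) g.1 (V := V))
    beta_reduce at h1
    rw [quaternion_re_trace_mul_comm _ (_ * star U), star_mul_conj (Unitary.mem_iff.1 hU).1,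
      trace_diagonal_mul_mul_diagonal_single quaternion_mul_star_self, ← hXs, ← hYs] at h1
    have h2 : (X * g.1 * Y * (g⁻¹).1).trace.re = _ := h1
    rw [h2]
    rfl
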